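/- Let $p\ge 0$ be an integer, let $\alpha(1),\dots,\alpha(p)\ge 2$ be integers, and let $X_1,X_2,\dots$ be independent and identically distributed random vectors $X_k=(X_k^{(1)},\dots,X_k^{(p)})$ with $X_k^{(i)}\in A_i:=\{0,\dots,\alpha(i)-1\}$. Let $Y_k=(Y_k^{(1)},\dots,Y_k^{(p)})\in\{0,1\}^p$, $k\ge1$, be any sequence of random vectors such that $(Y_k)_{k\ge 1}$ is independent of $(X_k)_{k\ge 1}$. The value $X_k^{(i)}$ is observed if $Y_k^{(i)}=1$ and is missing if $Y_k^{(i)}=0$. For $i\ne j$ let $[i,j]$ be the set of those $k\in\{1,\dots,n\}$ for which neither $X_k^{(i)}$ nor $X_k^{(j)}$ is missing, and let $n(i,j)$ be its cardinality. For a finite set $A$, parameters $a(x)>0$ $(x\in A)$ and a finite sequence in $A$ in which each $x\in A$ occurs $c(x)$ times, the Bayes measure of the sequence is $$\frac{\Gamma\left(\sum_x a(x)\right)}{\Gamma\left(\sum_x (c(x)+a(x))\right)}\prod_{x\in A}\frac{\Gamma(c(x)+a(x))}{\Gamma(a(x))}.$$ Fix positive parameters $a_i(x)$, $x\in A_i$,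 for each $i$, and positive parameters $a_{i,j}(x,y)$, $(x,y)\in A_i\times A_j$, for each $i\neq j$. Let $Q^n_j(i)$, $Q^n_i(j)$ and $Q^n(i,j)$ be the Bayes measures of $(X_k^{(i)})_{k\in[i,j]}$, $(X_k^{(j)})_{k\in[i,j]}$ and $((X_k^{(i)},X_k^{(j)}))_{k\in[i,j]}$ with the parameters $a_i$, $a_j$ and $a_{i,j}$, respectively, and let $$J^n(i,j)=\frac1n\log\frac{Q^n(i,j)}{Q^n_j(i)\,Q^n_i(j)},\qquad K^n(i,j)=\frac1{n(i,j)}\log\frac{Q^n(i,j)}{Q^n_j(i)\,Q^n_i(j)},$$ where $K^n(i,j):=0$ if $n(i,j)=0$. Let $I(i,j)$ be the mutual information of $X_1^{(i)}$ and $X_1^{(j)}$. Assume that $P(X_1^{(i)}=x)>0$ for all $i$ and all $x\in A_i$, or that all the parameters $a_i(x)$ and $a_{i,j}(x,y)$ are equal to $1/2$. Suppose that, for all $i\ne j$, $n(i,j)\to\infty$ as $n\to\infty$ with probability one. Then, with probability one, for all sufficiently large $n$ and all $i\ne j$, $$J^n(i,j)\le 0\iff I(i,j)=0\iff K^n(i,j)\le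 0 .$$ -/

import Mathlib

open MeasureTheory ProbabilityTheory Filter

namespace IncompleteData

/-- A data frame with columns indexed by `Fin p` and rows indexed by `ℕ`. Column `i` takes values in
`{0, …, α i - 1}` and the entry `none` stands for a missing value. The `n` samples are the rows
`0, …, n - 1`. -/
abbrev Frame {p : ℕ} (α : Fin p → ℕ) : Type :=
  ℕ → (i : Fin p) → Option (Fin (α i))

/-- The data frame obtained from the complete samples `x` by deleting the entry `(k, i)`
whenever `y k i = false`. -/
def mask {p : ℕ} {α : Fin p → ℕ} (x : ℕ → (i : Fin p) → Fin (α i)) (y : ℕ → Fin p → Bool) :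
    Frame α :=
  fun k i => if y k i then some (x k i) else none

/-- The set `[i,j]` of those among the first `n` rows in which neither the value of
column `i` nor the value of column `j` is missing. -/
def rows {p : ℕ} {α : Fin p → ℕ} (d : Frame α) (n : ℕ) (i j : Fin p) : Finset ℕ :=
  (Finset.range n).filter (fun k => (d k i).isSome ∧ (d k j).isSome)

/-- `n(i,j)`, the number of samples in which both `i` and `j` are observed. -/
def numObs {p : ℕ} {α : Fin p → ℕ} (d : Frame α) (n : ℕ) (i j : Fin p) : ℕ :=
  (rows d n i j).card

/-- The number of rows in the set `S` in which the value `x` occurs in column `i`. -/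
def count {p : ℕ} {α : Fin p → ℕ} (d : Frame α) (S : Finset ℕ) (i : Fin p) (x : Fin (α i)) : ℕ :=
  (S.filter (fun k => d k i = some x)).card

/-- The number of rows in the set `S` in which the pair of values `(x, y)` occurs in
the columns `i` and `j`. -/
def pairCount {p : ℕ} {α : Fin p → ℕ} (d : Frame α) (S : Finset ℕ) (i j : Fin p)
    (z : Fin (α i) × Fin (α j)) : ℕ :=
  (S.filter (fun k => d k i = some z.1 ∧ d k j = some z.2)).card

/-- The Bayes measure, with Dirichlet parameters `a`, of a sequence in which each value `x`
occurs `c x` times. -/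
noncomputable def bayesMeasure {A : Type*} [Fintype A] (a : A → ℝ) (c : A → ℕ) : ℝ :=
  Real.Gamma (∑ x, a x) / Real.Gamma (∑ x, ((c x : ℝ) + a x)) *
    ∏ x, (Real.Gamma ((c x : ℝ) + a x) / Real.Gamma (a x))

section Estimators

variable {p : ℕ} {α : Fin p → ℕ}

/-- The Bayes measure `Q_j^n(i)` of the values of column `i` in the rows `[i,j]`; with the arguments
`(j, i)` it is `Q_i^n(j)`. -/
noncomputable def qMarg (a : (i : Fin p) → Fin (α i) → ℝ) (d : Frame α) (n : ℕ) (i j : Fin p) : ℝ :=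
  bayesMeasure (a i) (count d (rows d n i j) i)

/-- The Bayes measure `Q^n(i,j)` of the pairs of values of the columns `i, j` in the rows `[i,j]`. -/
noncomputable def qJoint (b : (i j : Fin p) → Fin (α i) × Fin (α j) → ℝ) (d : Frame α) (n : ℕ)
    (i j : Fin p) : ℝ :=
  bayesMeasure (b i j) (pairCount d (rows d n i j) i j)

/-- The estimator `J^n(i,j)`. -/
noncomputable def estJ (a : (i : Fin p) → Fin (α i) → ℝ)
    (b : (i j : Fin p) → Fin (α i) × Fin (α j) → ℝ) (d : Frame α) (n : ℕ) (i j : Fin p) : ℝ :=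
  1 / (n : ℝ) * Real.log (qJoint b d n i j / (qMarg a d n i j * qMarg a d n j i))

/-- The estimator `K^n(i,j)`. -/
noncomputable def estK (a : (i : Fin p) → Fin (α i) → ℝ)
    (b : (i j : Fin p) → Fin (α i) × Fin (α j) → ℝ) (d : Frame α) (n : ℕ) (i j : Fin p) : ℝ :=
  1 / (numObs d n i j : ℝ) * Real.log (qJoint b d n i j / (qMarg a d n i j * qMarg a d n j i))

end Estimators

/-- The mutual information of two random variables with finitely many values. -/
noncomputable def mutualInfo {Ω A B : Type*} [MeasurableSpace Ω] [Fintype A] [Fintype B]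
    (P : Measure Ω) (U : Ω → A) (V : Ω → B) : ℝ :=
  ∑ x, ∑ y, P.real {ω | U ω = x ∧ V ω = y} *
    Real.log (P.real {ω | U ω = x ∧ V ω = y} / (P.real {ω | U ω = x} * P.real {ω | V ω = y}))

end IncompleteData

/-!
By Stirling's formula the logarithm of the Bayes measure of `N` observations from an alphabet of
size `k` is `-N` times their empirical entropy minus `(k - 1) / 2 * log N`, up to a bounded error.
Hence the logarithm of the ratio defining `J` and `K` is `N` times the empirical mutual information
minus `(|A| - 1) * (|B| - 1) / 2 * log N`, up to a bounded error. If the mutual information of the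
law is positive, the first term grows linearly and wins. If it is zero, the first term is at most
Pearson's `χ²` statistic, which is almost surely `o(log N)` because sums of `N` centred sub-Gaussian
variables are almost surely `o(√(N log N))`, so the second term wins. As the pattern of missing
values is independent of the samples, Fubini's theorem allows one to fix it, and the rows selected
by a fixed infinite pattern are again independent samples.
-/

namespace IncompleteData

open Asymptotics InformationTheory
open scoped Topology NNReal ENNReal

section Gamma

theorem tendsto_log_factorial_sub :
    Tendsto (fun n : ℕ => Real.log (n.factorial : ℝ) - (n * Real.log n - n + 1 / 2 * Real.log n))
      atTop (𝓝 (Real.log √Real.pi + Real.log 2 / 2)) := by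
  have hStirling : Tendsto (fun n => Real.log (Stirling.stirlingSeq n)) atTop
      (𝓝 (Real.log √Real.pi)) :=
    Stirling.tendsto_stirlingSeq_sqrt_pi.log (by positivity)
  refine (hStirling.add_const (Real.log 2 / 2)).congr' ?_
  filter_upwards [eventually_ne_atTop 0] with n hn
  have hn' : (n : ℝ) ≠ 0 := Nat.cast_ne_zero.2 hn
  rw [Stirling.log_stirlingSeq_formula, Real.log_mul two_ne_zero hn',
    Real.log_div hn' (Real.exp_ne_zero 1), Real.log_exp]
  ring

theorem log_Gamma_natCast_add {a : ℝ} (ha : 0 < a) (n : ℕ) :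
    Real.log (Real.Gamma (n + a)) =
      Real.log (Real.Gamma a) + ∑ m ∈ Finset.range n, Real.log (a + m) := by
  induction n with
  | zero => simp
  | succ n ih =>
    have hna : (0 : ℝ) < n + a := by positivity
    rw [Finset.sum_range_succ, ← add_assoc, ← ih, Nat.cast_succ, add_right_comm,
      Real.Gamma_add_one hna.ne', Real.log_mul hna.ne' (Real.Gamma_pos_of_pos hna).ne', add_comm a,
      add_comm]

/- `log Γ(n + a)` differs from `log n!` by the terms of the Bohr–Mollerup sequence, which reduces
the estimate to Stirling's formula for factorials. -/
theorem isBigO_log_Gamma_natCast_add_sub {a : ℝ} (ha : 0 < a) :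
    (fun n : ℕ => Real.log (Real.Gamma (n + a)) -
      (n * Real.log n - n + (a - 1 / 2) * Real.log n)) =O[⊤] fun _ => (1 : ℝ) := by
  have hshift : Tendsto (fun n : ℕ => Real.log (n + a) - Real.log n) atTop (𝓝 0) :=
    (Real.tendsto_log_comp_add_sub_log a).comp tendsto_natCast_atTop_atTop
  have hlim := (tendsto_log_factorial_sub.add
    ((Real.BohrMollerup.tendsto_log_gamma ha).const_sub (Real.log (Real.Gamma a)))).sub hshift
  suffices h : (fun n : ℕ => Real.log (Real.Gamma (n + a)) -
      (n * Real.log n - n + (a - 1 / 2) * Real.log n)) =O[atTop] fun _ => (1 : ℝ) by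
    simpa only [isBigO_top, norm_one, mul_one] using isBigO_one_nat_atTop_iff.1 h
  refine (hlim.congr fun n => ?_).isBigO_one ℝ
  rw [log_Gamma_natCast_add ha, Real.BohrMollerup.logGammaSeq, Finset.sum_range_succ, add_comm a]
  ring

end Gamma

section RelEntropy

variable {A : Type*} [Fintype A] {f g : A → ℝ}

/-- The relative entropy (Kullback–Leibler divergence) of two nonnegative weights on a finite type.
It has its usual meaning when `f` vanishes wherever `g` does; a point where only `g` vanishes
contributes `0` instead of `∞`. -/
noncomputable def relEntropy (f g : A → ℝ) : ℝ :=
  ∑ x, f x * Real.log (f x / g x)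

theorem relEntropy_eq_sum_klFun (hac : ∀ x, g x = 0 → f x = 0) (hsum : ∑ x, f x = ∑ x, g x) :
    relEntropy f g = ∑ x, g x * klFun (f x / g x) := by
  have hpoint : ∀ x, g x * klFun (f x / g x) = f x * Real.log (f x / g x) + g x - f x := fun x => by
    rw [klFun_apply, mul_sub, mul_add, mul_one, ← mul_assoc, mul_div_cancel_of_imp' (hac x)]
  simp only [hpoint, Finset.sum_sub_distrib, Finset.sum_add_distrib, hsum, add_sub_cancel_right,
    relEntropy]

theorem relEntropy_nonneg (hf : ∀ x, 0 ≤ f x) (hg : ∀ x, 0 ≤ g x) (hac : ∀ x, g x = 0 → f x = 0)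
    (hsum : ∑ x, f x = ∑ x, g x) : 0 ≤ relEntropy f g := by
  rw [relEntropy_eq_sum_klFun hac hsum]
  exact Finset.sum_nonneg fun x _ => mul_nonneg (hg x) (klFun_nonneg (div_nonneg (hf x) (hg x)))

theorem relEntropy_eq_zero_iff (hf : ∀ x, 0 ≤ f x) (hg : ∀ x, 0 ≤ g x)
    (hac : ∀ x, g x = 0 → f x = 0) (hsum : ∑ x, f x = ∑ x, g x) :
    relEntropy f g = 0 ↔ ∀ x, f x = g x := by
  rw [relEntropy_eq_sum_klFun hac hsum, Finset.sum_eq_zero_iff_of_nonneg fun x _ =>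
    mul_nonneg (hg x) (klFun_nonneg (div_nonneg (hf x) (hg x)))]
  refine ⟨fun h x => ?_, fun h x _ => ?_⟩
  · rcases mul_eq_zero.1 (h x (Finset.mem_univ x)) with hx | hx
    · rw [hx, hac x hx]
    · rw [klFun_eq_zero_iff (div_nonneg (hf x) (hg x))] at hx
      exact eq_of_div_eq_one hx
  · rcases eq_or_ne (g x) 0 with hx | hx
    · rw [hx, zero_mul]
    · rw [h x, div_self hx, klFun_one, mul_zero]

theorem klFun_le_sq_sub_one {x : ℝ} (hx : 0 ≤ x) : klFun x ≤ (x - 1) ^ 2 := by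
  rcases hx.eq_or_lt with rfl | hx
  · simp [klFun_zero]
  · have := mul_le_mul_of_nonneg_left (Real.log_le_sub_one_of_pos hx) hx.le
    rw [klFun_apply]
    linarith

theorem relEntropy_le_sum_sq_div (hf : ∀ x, 0 ≤ f x) (hg : ∀ x, 0 ≤ g x)
    (hac : ∀ x, g x = 0 → f x = 0) (hsum : ∑ x, f x = ∑ x, g x) :
    relEntropy f g ≤ ∑ x, (f x - g x) ^ 2 / g x := by
  rw [relEntropy_eq_sum_klFun hac hsum]
  refine Finset.sum_le_sum fun x _ => ?_
  rcases eq_or_ne (g x) 0 with hx | hx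
  · simp [hx]
  · calc g x * klFun (f x / g x)
        ≤ g x * (f x / g x - 1) ^ 2 :=
          mul_le_mul_of_nonneg_left (klFun_le_sq_sub_one (div_nonneg (hf x) (hg x))) (hg x)
      _ = (f x - g x) ^ 2 / g x := by field_simp

end RelEntropy

section Marginal

variable {A C : Type*} [DecidableEq A] [Fintype C]

/-- The push-forward along `φ` of a weight `f` on a finite type. For the projections of a product
it is a marginal of `f`. -/
def marginal {M : Type*} [AddCommMonoid M] (φ : C → A) (f : C → M) (x : A) : M :=
  ∑ z with φ z = x, f z

variable (φ : C → A)

theorem sum_marginal {M : Type*} [AddCommMonoid M] [Fintype A] (f : C → M) :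
    ∑ x, marginal φ f x = ∑ z, f z :=
  Finset.sum_fiberwise _ φ f

theorem sum_marginal_mul [Fintype A] (f : C → ℝ) (h : A → ℝ) :
    ∑ x, marginal φ f x * h x = ∑ z, f z * h (φ z) := by
  simp only [marginal, Finset.sum_mul]
  rw [← Finset.sum_fiberwise _ φ]
  refine Finset.sum_congr rfl fun x _ => Finset.sum_congr rfl fun z hz => ?_
  rw [(Finset.mem_filter.1 hz).2]

theorem marginal_smul (r : ℝ) (f : C → ℝ) : marginal φ (r • f) = r • marginal φ f := by
  funext x
  simp [marginal, Finset.mul_sum]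

theorem marginal_natCast (c : C → ℕ) :
    marginal φ (fun z => (c z : ℝ)) = fun x => ((marginal φ c x : ℕ) : ℝ) := by
  funext x
  simp [marginal]

theorem continuous_marginal : Continuous (marginal φ : (C → ℝ) → A → ℝ) := by
  unfold marginal
  fun_prop

theorem tendsto_smul_marginal_natCast {ι : Type*} {l : Filter ι} {r : ι → ℝ} {c : ι → C → ℕ}
    {p : C → ℝ} (h : Tendsto (fun n => r n • fun z => (c n z : ℝ)) l (𝓝 p)) :
    Tendsto (fun n => r n • fun x => ((marginal φ (c n) x : ℕ) : ℝ)) l (𝓝 (marginal φ p)) := by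
  simpa only [Function.comp_def, marginal_smul, marginal_natCast] using
    ((continuous_marginal φ).tendsto p).comp h

variable {φ}

theorem marginal_nonneg {f : C → ℝ} (hf : ∀ z, 0 ≤ f z) (x : A) : 0 ≤ marginal φ f x :=
  Finset.sum_nonneg fun z _ => hf z

theorem le_marginal_apply {f : C → ℝ} (hf : ∀ z, 0 ≤ f z) (z : C) : f z ≤ marginal φ f (φ z) :=
  Finset.single_le_sum (fun z _ => hf z) (Finset.mem_filter.2 ⟨Finset.mem_univ z, rfl⟩)

theorem eq_zero_of_marginal_apply_eq_zero {f : C → ℝ} (hf : ∀ z, 0 ≤ f z) {z : C}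
    (h : marginal φ f (φ z) = 0) : f z = 0 :=
  le_antisymm ((le_marginal_apply hf z).trans_eq h) (hf z)

theorem marginal_mem_stdSimplex [Fintype A] {p : C → ℝ} (hp : p ∈ stdSimplex ℝ C) :
    marginal φ p ∈ stdSimplex ℝ A :=
  ⟨marginal_nonneg hp.1, (sum_marginal φ p).trans hp.2⟩

theorem marginal_eq_zero_of_imp {f p : C → ℝ} (hp : ∀ z, 0 ≤ p z) (hac : ∀ z, p z = 0 → f z = 0)
    {x : A} (hx : marginal φ p x = 0) : marginal φ f x = 0 :=
  Finset.sum_eq_zero fun z hz => hac z <|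
    (Finset.sum_eq_zero_iff_of_nonneg fun z _ => hp z).1 hx z hz

end Marginal

section NegEntropy

variable {A : Type*} [Fintype A]

/-- The negative of the Shannon entropy of a weight `f`, multiplied by the total mass of `f`. For
the counts of a finite sequence it is the maximal log-likelihood of an i.i.d. model. -/
noncomputable def negEntropy (f : A → ℝ) : ℝ :=
  ∑ x, f x * Real.log (f x) - (∑ x, f x) * Real.log (∑ x, f x)

theorem continuous_negEntropy : Continuous (negEntropy : (A → ℝ) → ℝ) :=
  (continuous_finsetSum _ fun x _ => Real.continuous_mul_log.comp (continuous_apply x)).sub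
    (Real.continuous_mul_log.comp (continuous_finsetSum _ fun x _ => continuous_apply x))

theorem negEntropy_smul (r : ℝ) (f : A → ℝ) : negEntropy (r • f) = r * negEntropy f := by
  have hmul : ∀ u : ℝ, r * u * Real.log (r * u) = r * Real.log r * u + r * (u * Real.log u) := by
    intro u
    have h := Real.negMulLog_mul r u
    simp only [Real.negMulLog] at h
    linarith
  simp only [negEntropy, Pi.smul_apply, smul_eq_mul, ← Finset.mul_sum, hmul,
    Finset.sum_add_distrib]
  ring

theorem negEntropy_of_sum_eq_one {p : A → ℝ} (hp : ∑ x, p x = 1) :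
    negEntropy p = ∑ x, p x * Real.log (p x) := by
  rw [negEntropy, hp, Real.log_one, mul_zero, sub_zero]

theorem negEntropy_eq_sum_mul_log_add_relEntropy {f p : A → ℝ} (hf : ∀ x, 0 ≤ f x)
    (hac : ∀ x, p x = 0 → f x = 0) :
    negEntropy f = ∑ x, f x * Real.log (p x) + relEntropy f ((∑ x, f x) • p) := by
  rw [negEntropy, relEntropy, Finset.sum_mul, ← Finset.sum_sub_distrib, ← Finset.sum_add_distrib]
  refine Finset.sum_congr rfl fun x _ => ?_
  rcases eq_or_ne (f x) 0 with hx | hx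
  · simp [hx]
  · have hsum : ∑ x, f x ≠ 0 := fun h =>
      hx ((Finset.sum_eq_zero_iff_of_nonneg fun x _ => hf x).1 h x (Finset.mem_univ x))
    have hpx : p x ≠ 0 := mt (hac x) hx
    rw [Pi.smul_apply, smul_eq_mul, Real.log_div hx (mul_ne_zero hsum hpx), Real.log_mul hsum hpx]
    ring

theorem eq_zero_of_sum_smul_apply_eq_zero {f p : A → ℝ} (hf : ∀ x, 0 ≤ f x)
    (hac : ∀ x, p x = 0 → f x = 0) {x : A} (hx : ((∑ x, f x) • p) x = 0) : f x = 0 :=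
  (mul_eq_zero.1 hx).elim
    (fun h => (Finset.sum_eq_zero_iff_of_nonneg fun x _ => hf x).1 h x (Finset.mem_univ x)) (hac x)

theorem sum_mul_log_le_negEntropy {f p : A → ℝ} (hf : ∀ x, 0 ≤ f x) (hp : p ∈ stdSimplex ℝ A)
    (hac : ∀ x, p x = 0 → f x = 0) : ∑ x, f x * Real.log (p x) ≤ negEntropy f := by
  rw [negEntropy_eq_sum_mul_log_add_relEntropy hf hac]
  refine le_add_of_nonneg_right (relEntropy_nonneg hf ?_ ?_ ?_)
  · exact fun x => mul_nonneg (Finset.sum_nonneg fun x _ => hf x) (hp.1 x)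
  · exact fun x hx => eq_zero_of_sum_smul_apply_eq_zero hf hac hx
  · simp [← Finset.mul_sum, hp.2]

end NegEntropy

section MassMutualInfo

variable {A B : Type*} [Fintype A] [Fintype B] [DecidableEq A] [DecidableEq B]

/-- The mutual information of the two coordinates under a weight `f` on a product, multiplied by
the total mass of `f`. For counts of pairs it is the log-likelihood ratio of dependence against
independence. -/
noncomputable def massMutualInfo (f : A × B → ℝ) : ℝ :=
  negEntropy f - negEntropy (marginal Prod.fst f) - negEntropy (marginal Prod.snd f)

theorem continuous_massMutualInfo : Continuous (massMutualInfo : (A × B → ℝ) → ℝ) :=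
  (continuous_negEntropy.sub (continuous_negEntropy.comp (continuous_marginal _))).sub
    (continuous_negEntropy.comp (continuous_marginal _))

theorem massMutualInfo_smul (r : ℝ) (f : A × B → ℝ) :
    massMutualInfo (r • f) = r * massMutualInfo f := by
  simp only [massMutualInfo, marginal_smul, negEntropy_smul]
  ring

variable {f p : A × B → ℝ}

theorem massMutualInfo_eq_relEntropy (hp : p ∈ stdSimplex ℝ (A × B)) :
    massMutualInfo p =
      relEntropy p fun z => marginal Prod.fst p z.1 * marginal Prod.snd p z.2 := by
  rw [massMutualInfo, negEntropy_of_sum_eq_one hp.2,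
    negEntropy_of_sum_eq_one (marginal_mem_stdSimplex hp).2,
    negEntropy_of_sum_eq_one (marginal_mem_stdSimplex hp).2, sum_marginal_mul, sum_marginal_mul,
    relEntropy, ← Finset.sum_sub_distrib, ← Finset.sum_sub_distrib]
  refine Finset.sum_congr rfl fun z _ => ?_
  rcases eq_or_ne (p z) 0 with hz | hz
  · simp only [hz, zero_mul, sub_zero]
  · have h₁ : marginal Prod.fst p z.1 ≠ 0 := mt (eq_zero_of_marginal_apply_eq_zero hp.1) hz
    have h₂ : marginal Prod.snd p z.2 ≠ 0 := mt (eq_zero_of_marginal_apply_eq_zero hp.1) hz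
    rw [Real.log_div hz (mul_ne_zero h₁ h₂), Real.log_mul h₁ h₂]
    ring

theorem eq_zero_of_marginal_mul_eq_zero (hp : ∀ z, 0 ≤ p z) {z : A × B}
    (hz : marginal Prod.fst p z.1 * marginal Prod.snd p z.2 = 0) : p z = 0 :=
  (mul_eq_zero.1 hz).elim (eq_zero_of_marginal_apply_eq_zero hp)
    (eq_zero_of_marginal_apply_eq_zero hp)

theorem sum_marginal_mul_marginal (hp : p ∈ stdSimplex ℝ (A × B)) :
    ∑ z : A × B, marginal Prod.fst p z.1 * marginal Prod.snd p z.2 = 1 := by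
  rw [Fintype.sum_prod_type, ← Finset.sum_mul_sum, (marginal_mem_stdSimplex hp).2,
    (marginal_mem_stdSimplex hp).2, one_mul]

theorem massMutualInfo_nonneg (hp : p ∈ stdSimplex ℝ (A × B)) : 0 ≤ massMutualInfo p := by
  rw [massMutualInfo_eq_relEntropy hp]
  exact relEntropy_nonneg hp.1
    (fun z => mul_nonneg (marginal_nonneg hp.1 _) (marginal_nonneg hp.1 _))
    (fun z => eq_zero_of_marginal_mul_eq_zero hp.1) (hp.2.trans (sum_marginal_mul_marginal hp).symm)

theorem massMutualInfo_eq_zero_iff (hp : p ∈ stdSimplex ℝ (A × B)) :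
    massMutualInfo p = 0 ↔ ∀ z, p z = marginal Prod.fst p z.1 * marginal Prod.snd p z.2 := by
  rw [massMutualInfo_eq_relEntropy hp]
  exact relEntropy_eq_zero_iff hp.1
    (fun z => mul_nonneg (marginal_nonneg hp.1 _) (marginal_nonneg hp.1 _))
    (fun z => eq_zero_of_marginal_mul_eq_zero hp.1) (hp.2.trans (sum_marginal_mul_marginal hp).symm)

theorem massMutualInfo_le_relEntropy (hf : ∀ z, 0 ≤ f z) (hp : p ∈ stdSimplex ℝ (A × B))
    (hac : ∀ z, p z = 0 → f z = 0)
    (hind : ∀ z, p z = marginal Prod.fst p z.1 * marginal Prod.snd p z.2) :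
    massMutualInfo f ≤ relEntropy f ((∑ z, f z) • p) := by
  have hlog : ∑ z, f z * Real.log (p z) =
      ∑ x, marginal Prod.fst f x * Real.log (marginal Prod.fst p x) +
        ∑ y, marginal Prod.snd f y * Real.log (marginal Prod.snd p y) := by
    rw [sum_marginal_mul, sum_marginal_mul, ← Finset.sum_add_distrib]
    refine Finset.sum_congr rfl fun z _ => ?_
    rcases eq_or_ne (p z) 0 with hz | hz
    · simp only [hac z hz, zero_mul, add_zero]
    · have hz' := hind z ▸ hz
      rw [hind z, Real.log_mul (left_ne_zero_of_mul hz') (right_ne_zero_of_mul hz'), mul_add]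
  have h₁ := sum_mul_log_le_negEntropy (marginal_nonneg (φ := Prod.fst) hf)
    (marginal_mem_stdSimplex hp) fun x => marginal_eq_zero_of_imp hp.1 hac
  have h₂ := sum_mul_log_le_negEntropy (marginal_nonneg (φ := Prod.snd) hf)
    (marginal_mem_stdSimplex hp) fun x => marginal_eq_zero_of_imp hp.1 hac
  rw [massMutualInfo, negEntropy_eq_sum_mul_log_add_relEntropy hf hac]
  linarith

theorem massMutualInfo_le_sum_sq_div (hf : ∀ z, 0 ≤ f z) (hp : p ∈ stdSimplex ℝ (A × B))
    (hac : ∀ z, p z = 0 → f z = 0)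
    (hind : ∀ z, p z = marginal Prod.fst p z.1 * marginal Prod.snd p z.2) :
    massMutualInfo f ≤ ∑ z, (f z - (∑ z, f z) * p z) ^ 2 / ((∑ z, f z) * p z) :=
  (massMutualInfo_le_relEntropy hf hp hac hind).trans <| relEntropy_le_sum_sq_div hf
    (fun z => mul_nonneg (Finset.sum_nonneg fun z _ => hf z) (hp.1 z))
    (fun z => eq_zero_of_sum_smul_apply_eq_zero hf hac)
    (by simp only [Pi.smul_apply, smul_eq_mul, ← Finset.mul_sum, hp.2, mul_one])

end MassMutualInfo

section BayesMeasure

variable {A : Type*} [Fintype A] {a : A → ℝ} {c : ℕ → A → ℕ}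

theorem isBigO_sum_mul_log_sub_log {p : A → ℝ}
    (hlim : Tendsto (fun N : ℕ => (N : ℝ)⁻¹ • fun x => (c N x : ℝ)) atTop (𝓝 p))
    (h : (∀ x, 0 < p x) ∨ ∀ x, a x = 1 / 2) :
    (fun N : ℕ => ∑ x, (a x - 1 / 2) * (Real.log (c N x) - Real.log N)) =O[atTop]
      fun _ => (1 : ℝ) := by
  rcases h with h | h
  · refine IsBigO.fun_sum fun x _ =>
      ((((tendsto_pi_nhds.1 hlim x).log (h x).ne').congr' ?_).isBigO_one ℝ).const_mul_left _
    filter_upwards [(tendsto_pi_nhds.1 hlim x).eventually_ne (h x).ne'] with N hN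
    have hN' := mt inv_eq_zero.2 (left_ne_zero_of_mul hN)
    rw [Pi.smul_apply, smul_eq_mul, Real.log_mul (inv_ne_zero hN') (right_ne_zero_of_mul hN),
      Real.log_inv]
    ring
  · simpa only [h, sub_self, zero_mul, Finset.sum_const_zero] using isBigO_zero _ _

variable [Nonempty A]

theorem bayesMeasure_pos (ha : ∀ x, 0 < a x) (c : A → ℕ) : 0 < bayesMeasure a c := by
  have hca : ∀ x, 0 < (c x : ℝ) + a x := fun x => add_pos_of_nonneg_of_pos (Nat.cast_nonneg _)
    (ha x)
  exact mul_pos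
    (div_pos (Real.Gamma_pos_of_pos (Finset.sum_pos (fun x _ => ha x) Finset.univ_nonempty))
      (Real.Gamma_pos_of_pos (Finset.sum_pos (fun x _ => hca x) Finset.univ_nonempty)))
    (Finset.prod_pos fun x _ =>
      div_pos (Real.Gamma_pos_of_pos (hca x)) (Real.Gamma_pos_of_pos (ha x)))

theorem log_bayesMeasure (ha : ∀ x, 0 < a x) (c : A → ℕ) :
    Real.log (bayesMeasure a c) =
      Real.log (Real.Gamma (∑ x, a x)) - Real.log (Real.Gamma ((∑ x, c x : ℕ) + ∑ x, a x)) +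
        (∑ x, Real.log (Real.Gamma (c x + a x)) - ∑ x, Real.log (Real.Gamma (a x))) := by
  have hsum : 0 < ∑ x, a x := Finset.sum_pos (fun x _ => ha x) Finset.univ_nonempty
  have hΓ : ∀ {r : ℝ}, 0 < r → ∀ n : ℕ, Real.Gamma (n + r) ≠ 0 := fun hr n =>
    (Real.Gamma_pos_of_pos (add_pos_of_nonneg_of_pos n.cast_nonneg hr)).ne'
  have hΓ₀ : ∀ {r : ℝ}, 0 < r → Real.Gamma r ≠ 0 := fun hr => (Real.Gamma_pos_of_pos hr).ne'
  have hdiv : ∀ x, Real.Gamma (c x + a x) / Real.Gamma (a x) ≠ 0 := fun x =>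
    div_ne_zero (hΓ (ha x) _) (hΓ₀ (ha x))
  rw [bayesMeasure, Finset.sum_add_distrib, ← Nat.cast_sum,
    Real.log_mul (div_ne_zero (hΓ₀ hsum) (hΓ hsum _)) (Finset.prod_ne_zero_iff.2 fun x _ => hdiv x),
    Real.log_div (hΓ₀ hsum) (hΓ hsum _), Real.log_prod fun x _ => hdiv x, ← Finset.sum_sub_distrib]
  exact congrArg₂ _ rfl (Finset.sum_congr rfl fun x _ => Real.log_div (hΓ (ha x) _) (hΓ₀ (ha x)))

theorem isBigO_log_bayesMeasure_sub (ha : ∀ x, 0 < a x) :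
    (fun c : A → ℕ => Real.log (bayesMeasure a c) -
      (negEntropy (fun x => (c x : ℝ)) + ∑ x, (a x - 1 / 2) * Real.log (c x) -
        (∑ x, a x - 1 / 2) * Real.log (∑ x, c x : ℕ))) =O[⊤] fun _ => (1 : ℝ) := by
  have hterm := IsBigO.fun_sum (s := Finset.univ) fun x _ =>
    (isBigO_log_Gamma_natCast_add_sub (ha x)).comp_tendsto (k := fun c : A → ℕ => c x)
      (l' := ⊤) tendsto_top
  have htotal := (isBigO_log_Gamma_natCast_add_sub
    (Finset.sum_pos (fun x _ => ha x) Finset.univ_nonempty)).comp_tendsto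
      (k := fun c : A → ℕ => ∑ x, c x) (l' := ⊤) tendsto_top
  refine ((hterm.sub htotal).add (isBigO_const_one ℝ (Real.log (Real.Gamma (∑ x, a x)) -
    ∑ x, Real.log (Real.Gamma (a x))) _)).congr_left fun c => ?_
  simp only [log_bayesMeasure ha, negEntropy, Function.comp_apply,
    Finset.sum_sub_distrib, Finset.sum_add_distrib, Nat.cast_sum]
  ring

theorem isBigO_log_bayesMeasure_sub_negEntropy (ha : ∀ x, 0 < a x) (hc : ∀ N, ∑ x, c N x = N) :
    (fun N => Real.log (bayesMeasure a (c N)) - negEntropy fun x => (c N x : ℝ)) =O[atTop]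
      fun N : ℕ => Real.log N := by
  have hle : ∀ N x, c N x ≤ N := fun N x =>
    (Finset.single_le_sum (fun _ _ => Nat.zero_le _) (Finset.mem_univ x)).trans_eq (hc N)
  have hlog : ∀ x, (fun N => Real.log (c N x)) =O[atTop] fun N : ℕ => Real.log N := fun x =>
    .of_norm_le fun N => by
      rw [Real.norm_of_nonneg (Real.log_natCast_nonneg _)]
      rcases (c N x).eq_zero_or_pos with h0 | h0
      · simpa only [h0, Nat.cast_zero, Real.log_zero] using Real.log_natCast_nonneg N
      · exact Real.log_le_log (Nat.cast_pos.2 h0) (Nat.cast_le.2 (hle N x))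
  have hone : (fun _ => (1 : ℝ)) =O[atTop] fun N : ℕ => Real.log N :=
    (Real.isLittleO_const_log_atTop.comp_tendsto tendsto_natCast_atTop_atTop).isBigO
  have hrem := ((isBigO_log_bayesMeasure_sub ha).comp_tendsto (tendsto_top (f := c))).trans hone
  have hsum := IsBigO.fun_sum (s := Finset.univ) fun x _ => (hlog x).const_mul_left (a x - 1 / 2)
  refine ((hrem.add hsum).sub
    ((isBigO_refl _ _).const_mul_left (∑ x, a x - 1 / 2))).congr_left fun N => ?_
  simp only [Function.comp_apply, hc]
  ring

theorem isBigO_log_bayesMeasure_sub_negEntropy_sub_log {p : A → ℝ} (ha : ∀ x, 0 < a x)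
    (hc : ∀ N, ∑ x, c N x = N)
    (hlim : Tendsto (fun N : ℕ => (N : ℝ)⁻¹ • fun x => (c N x : ℝ)) atTop (𝓝 p))
    (h : (∀ x, 0 < p x) ∨ ∀ x, a x = 1 / 2) :
    (fun N => Real.log (bayesMeasure a (c N)) - ((negEntropy fun x => (c N x : ℝ)) -
      ((Fintype.card A : ℝ) - 1) / 2 * Real.log N)) =O[atTop] fun _ => (1 : ℝ) := by
  refine (((isBigO_log_bayesMeasure_sub ha).comp_tendsto (tendsto_top (f := c))).add
    (isBigO_sum_mul_log_sub_log hlim h)).congr_left fun N => ?_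
  simp only [Function.comp_apply, hc, mul_sub, Finset.sum_sub_distrib, ← Finset.sum_mul,
    Finset.sum_const, Finset.card_univ, nsmul_eq_mul]
  ring

end BayesMeasure

section LogRatio

variable {A B : Type*} [Fintype A] [Fintype B] [DecidableEq A] [DecidableEq B]

/-- The logarithm of the ratio of the Bayes measure of a sequence of pairs, in which each pair `z`
occurs `c z` times, to the product of the Bayes measures of the two sequences of coordinates. -/
noncomputable def logRatio (a₁ : A → ℝ) (a₂ : B → ℝ) (b : A × B → ℝ) (c : A × B → ℕ) : ℝ :=
  Real.log (bayesMeasure b c /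
    (bayesMeasure a₁ (marginal Prod.fst c) * bayesMeasure a₂ (marginal Prod.snd c)))

variable [Nonempty A] [Nonempty B] {a₁ : A → ℝ} {a₂ : B → ℝ} {b : A × B → ℝ}

theorem logRatio_sub_massMutualInfo (ha₁ : ∀ x, 0 < a₁ x) (ha₂ : ∀ y, 0 < a₂ y)
    (hb : ∀ z, 0 < b z) (c : A × B → ℕ) :
    logRatio a₁ a₂ b c - massMutualInfo (fun z => (c z : ℝ)) =
      (Real.log (bayesMeasure b c) - negEntropy fun z => (c z : ℝ)) -
        (Real.log (bayesMeasure a₁ (marginal Prod.fst c)) -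
          negEntropy fun x => ((marginal Prod.fst c x : ℕ) : ℝ)) -
        (Real.log (bayesMeasure a₂ (marginal Prod.snd c)) -
          negEntropy fun y => ((marginal Prod.snd c y : ℕ) : ℝ)) := by
  have h₁ := (bayesMeasure_pos ha₁ (marginal Prod.fst c)).ne'
  have h₂ := (bayesMeasure_pos ha₂ (marginal Prod.snd c)).ne'
  rw [logRatio, Real.log_div (bayesMeasure_pos hb c).ne' (mul_ne_zero h₁ h₂), Real.log_mul h₁ h₂,
    massMutualInfo, marginal_natCast, marginal_natCast]
  ring

variable {c : ℕ → A × B → ℕ}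

theorem isBigO_logRatio_sub_massMutualInfo (ha₁ : ∀ x, 0 < a₁ x) (ha₂ : ∀ y, 0 < a₂ y)
    (hb : ∀ z, 0 < b z) (hc : ∀ N, ∑ z, c N z = N) :
    (fun N => logRatio a₁ a₂ b (c N) - massMutualInfo fun z => (c N z : ℝ)) =O[atTop]
      fun N : ℕ => Real.log N := by
  simp only [logRatio_sub_massMutualInfo ha₁ ha₂ hb]
  exact ((isBigO_log_bayesMeasure_sub_negEntropy hb hc).sub
    (isBigO_log_bayesMeasure_sub_negEntropy ha₁ fun N => (sum_marginal _ _).trans (hc N))).sub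
    (isBigO_log_bayesMeasure_sub_negEntropy ha₂ fun N => (sum_marginal _ _).trans (hc N))

theorem isBigO_logRatio_sub_massMutualInfo_sub_log {p : A × B → ℝ} (ha₁ : ∀ x, 0 < a₁ x)
    (ha₂ : ∀ y, 0 < a₂ y) (hb : ∀ z, 0 < b z) (hc : ∀ N, ∑ z, c N z = N)
    (hlim : Tendsto (fun N : ℕ => (N : ℝ)⁻¹ • fun z => (c N z : ℝ)) atTop (𝓝 p))
    (hp₁ : (∀ x, 0 < marginal Prod.fst p x) ∨ ∀ x, a₁ x = 1 / 2)
    (hp₂ : (∀ y, 0 < marginal Prod.snd p y) ∨ ∀ y, a₂ y = 1 / 2)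
    (hp : (∀ z, 0 < p z) ∨ ∀ z, b z = 1 / 2) :
    (fun N => logRatio a₁ a₂ b (c N) - ((massMutualInfo fun z => (c N z : ℝ)) -
      ((Fintype.card A : ℝ) - 1) * (Fintype.card B - 1) / 2 * Real.log N)) =O[atTop]
        fun _ => (1 : ℝ) := by
  refine (((isBigO_log_bayesMeasure_sub_negEntropy_sub_log hb hc hlim hp).sub
    (isBigO_log_bayesMeasure_sub_negEntropy_sub_log ha₁ (fun N => (sum_marginal _ _).trans (hc N))
      (tendsto_smul_marginal_natCast _ hlim) hp₁)).sub
    (isBigO_log_bayesMeasure_sub_negEntropy_sub_log ha₂ (fun N => (sum_marginal _ _).trans (hc N))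
      (tendsto_smul_marginal_natCast _ hlim) hp₂)).congr_left fun N => ?_
  have hsplit := logRatio_sub_massMutualInfo ha₁ ha₂ hb (c N)
  rw [Fintype.card_prod, Nat.cast_mul]
  linear_combination -hsplit

end LogRatio

section TypicalCounts

theorem isLittleO_log_natCast : (fun N : ℕ => Real.log N) =o[atTop] fun N : ℕ => (N : ℝ) :=
  Real.isLittleO_log_id_atTop.comp_tendsto tendsto_natCast_atTop_atTop

/-- The counts `c N` of the values in samples of size `N` deviate from their expectations `N * p` by
`o(√(N log N))`, and values of probability `0` do not occur. -/
structure IsTypicalCounts {C : Type*} [Fintype C] (p : C → ℝ) (c : ℕ → C → ℕ) : Prop where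
  sum_eq : ∀ N, ∑ z, c N z = N
  eq_zero : ∀ z, p z = 0 → ∀ N, c N z = 0
  isLittleO_sq : ∀ z,
    (fun N : ℕ => ((c N z : ℝ) - N * p z) ^ 2) =o[atTop] fun N : ℕ => N * Real.log N

namespace IsTypicalCounts

variable {C : Type*} [Fintype C] {p : C → ℝ} {c : ℕ → C → ℕ}

theorem tendsto_inv_smul (h : IsTypicalCounts p c) :
    Tendsto (fun N : ℕ => (N : ℝ)⁻¹ • fun z => (c N z : ℝ)) atTop (𝓝 p) := by
  refine tendsto_pi_nhds.2 fun z => ?_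
  have hsq : (fun N : ℕ => ((c N z : ℝ) - N * p z) ^ 2) =o[atTop] fun N : ℕ => (N : ℝ) ^ 2 := by
    refine (h.isLittleO_sq z).trans ?_
    simpa only [pow_two] using (isBigO_refl (fun N : ℕ => (N : ℝ)) atTop).mul_isLittleO
      isLittleO_log_natCast
  have hdev := (hsq.of_pow two_ne_zero).tendsto_div_nhds_zero.add_const (p z)
  rw [zero_add] at hdev
  refine hdev.congr' ?_
  filter_upwards [eventually_ne_atTop 0] with N hN
  rw [Pi.smul_apply, smul_eq_mul]
  field_simp
  ring

theorem mem_stdSimplex (h : IsTypicalCounts p c) : p ∈ stdSimplex ℝ C := by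
  refine (isClosed_stdSimplex ℝ C).mem_of_tendsto h.tendsto_inv_smul ?_
  filter_upwards [eventually_ne_atTop 0] with N hN
  refine ⟨fun z => mul_nonneg (by positivity) (Nat.cast_nonneg _), ?_⟩
  simp only [Pi.smul_apply, smul_eq_mul, ← Finset.mul_sum, ← Nat.cast_sum, h.sum_eq]
  exact inv_mul_cancel₀ (Nat.cast_ne_zero.2 hN)

theorem isLittleO_sum_sq_div (h : IsTypicalCounts p c) :
    (fun N : ℕ => ∑ z, ((c N z : ℝ) - N * p z) ^ 2 / (N * p z)) =o[atTop]
      fun N : ℕ => Real.log N := by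
  refine IsLittleO.fun_sum fun z _ => ?_
  have hratio : (fun N : ℕ => N * Real.log N * (N * p z)⁻¹) =O[atTop] fun N : ℕ => Real.log N := by
    refine (isBigO_const_mul_self (p z)⁻¹ (fun N : ℕ => Real.log N) atTop).congr' ?_ .rfl
    filter_upwards [eventually_ne_atTop 0] with N hN
    rw [mul_inv]
    field_simp
  exact ((h.isLittleO_sq z).mul_isBigO (isBigO_refl _ _)).trans_isBigO hratio

variable {A B : Type*} [Fintype A] [Fintype B] [DecidableEq A] [DecidableEq B]
  {a₁ : A → ℝ} {a₂ : B → ℝ} {b : A × B → ℝ} {p : A × B → ℝ} {c : ℕ → A × B → ℕ}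

theorem tendsto_logRatio_div [Nonempty A] [Nonempty B] (h : IsTypicalCounts p c)
    (ha₁ : ∀ x, 0 < a₁ x) (ha₂ : ∀ y, 0 < a₂ y) (hb : ∀ z, 0 < b z) :
    Tendsto (fun N => logRatio a₁ a₂ b (c N) / N) atTop (𝓝 (massMutualInfo p)) := by
  have hMI := (continuous_massMutualInfo.tendsto p).comp h.tendsto_inv_smul
  have hrem := ((isBigO_logRatio_sub_massMutualInfo ha₁ ha₂ hb h.sum_eq).trans_isLittleO
    isLittleO_log_natCast).tendsto_div_nhds_zero
  rw [← add_zero (massMutualInfo p)]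
  refine (hMI.add hrem).congr fun N => ?_
  rw [Function.comp_apply, massMutualInfo_smul]
  ring

theorem eventually_logRatio_nonpos [Nontrivial A] [Nontrivial B] (h : IsTypicalCounts p c)
    (ha₁ : ∀ x, 0 < a₁ x) (ha₂ : ∀ y, 0 < a₂ y) (hb : ∀ z, 0 < b z)
    (hp : ((∀ x, 0 < marginal Prod.fst p x) ∧ ∀ y, 0 < marginal Prod.snd p y) ∨
      (∀ x, a₁ x = 1 / 2) ∧ (∀ y, a₂ y = 1 / 2) ∧ ∀ z, b z = 1 / 2)
    (hMI : massMutualInfo p = 0) : ∀ᶠ N in atTop, logRatio a₁ a₂ b (c N) ≤ 0 := by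
  have hind := (massMutualInfo_eq_zero_iff h.mem_stdSimplex).1 hMI
  have hrem := (isBigO_logRatio_sub_massMutualInfo_sub_log ha₁ ha₂ hb h.sum_eq h.tendsto_inv_smul
    (hp.imp And.left And.left) (hp.imp And.right fun h => h.2.1)
    (hp.imp (fun h z => by rw [hind]; exact mul_pos (h.1 _) (h.2 _))
      fun h => h.2.2)).trans_isLittleO
    (Real.isLittleO_const_log_atTop.comp_tendsto tendsto_natCast_atTop_atTop)
  have hchi : ∀ N : ℕ, massMutualInfo (fun z => (c N z : ℝ)) ≤
      ∑ z, ((c N z : ℝ) - N * p z) ^ 2 / (N * p z) := fun N => by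
    simpa only [← Nat.cast_sum, h.sum_eq] using massMutualInfo_le_sum_sq_div
      (fun z => Nat.cast_nonneg (c N z)) h.mem_stdSimplex
      (fun z hz => Nat.cast_eq_zero.2 (h.eq_zero z hz N)) hind
  have hcard : 0 < ((Fintype.card A : ℝ) - 1) * (Fintype.card B - 1) / 2 := by
    have hA : (1 : ℝ) < Fintype.card A := Nat.one_lt_cast.2 Fintype.one_lt_card
    have hB : (1 : ℝ) < Fintype.card B := Nat.one_lt_cast.2 Fintype.one_lt_card
    exact half_pos (mul_pos (sub_pos.2 hA) (sub_pos.2 hB))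
  filter_upwards [(hrem.add h.isLittleO_sum_sq_div).def hcard] with N hN
  rw [Function.comp_apply, Real.norm_of_nonneg (Real.log_natCast_nonneg N)] at hN
  linarith [hchi N, (le_abs_self _).trans hN]

theorem eventually_logRatio_nonpos_iff [Nontrivial A] [Nontrivial B] (h : IsTypicalCounts p c)
    (ha₁ : ∀ x, 0 < a₁ x) (ha₂ : ∀ y, 0 < a₂ y) (hb : ∀ z, 0 < b z)
    (hp : ((∀ x, 0 < marginal Prod.fst p x) ∧ ∀ y, 0 < marginal Prod.snd p y) ∨
      (∀ x, a₁ x = 1 / 2) ∧ (∀ y, a₂ y = 1 / 2) ∧ ∀ z, b z = 1 / 2) :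
    ∀ᶠ N in atTop, (logRatio a₁ a₂ b (c N) ≤ 0 ↔ massMutualInfo p = 0) := by
  rcases (massMutualInfo_nonneg h.mem_stdSimplex).eq_or_lt with hMI | hMI
  · filter_upwards [h.eventually_logRatio_nonpos ha₁ ha₂ hb hp hMI.symm] with N hN
    exact iff_of_true hN hMI.symm
  · filter_upwards [(h.tendsto_logRatio_div ha₁ ha₂ hb).eventually_const_lt hMI] with N hN
    refine iff_of_false (fun hle => hN.not_ge ?_) hMI.ne'
    exact div_nonpos_of_nonpos_of_nonneg hle N.cast_nonneg

end IsTypicalCounts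

end TypicalCounts

section MaximalInequality

variable {Ω : Type*} [MeasurableSpace Ω] {P : Measure Ω}

theorem measure_exists_le_le_of_submartingale [IsFiniteMeasure P] {M : ℕ → Ω → ℝ}
    {𝒢 : Filtration ℕ ‹MeasurableSpace Ω›} (hM : Submartingale M 𝒢 P) (hnonneg : 0 ≤ M) {r : ℝ≥0}
    (hr : 0 < r) (n : ℕ) :
    P {ω | ∃ m ≤ n, (r : ℝ) ≤ M m ω} ≤ ENNReal.ofReal ((∫ ω, M n ω ∂P) / r) := by
  have hset : {ω | ∃ m ≤ n, (r : ℝ) ≤ M m ω} =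
      {ω | (r : ℝ) ≤ (Finset.range (n + 1)).sup' Finset.nonempty_range_add_one fun m => M m ω} := by
    ext ω
    simp [Finset.le_sup'_iff]
  rw [ENNReal.ofReal_div_of_pos (NNReal.coe_pos.2 hr), ENNReal.ofReal_coe_nnreal,
    ENNReal.le_div_iff_mul_le (.inl (ENNReal.coe_ne_zero.2 hr.ne')) (.inl ENNReal.coe_ne_top),
    mul_comm, hset]
  exact (maximal_ineq hM hnonneg n).trans (ENNReal.ofReal_le_ofReal
    (setIntegral_le_integral (hM.integrable n) (ae_of_all _ fun ω => hnonneg n ω)))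

variable [IsProbabilityMeasure P] {f : ℕ → Ω → ℝ}

theorem integrable_prod_range (hmeas : ∀ k, Measurable (f k)) (hindep : iIndepFun f P)
    (hint : ∀ k, Integrable (f k) P) (n : ℕ) : Integrable (∏ k ∈ Finset.range n, f k) P := by
  induction n with
  | zero => exact integrable_const 1
  | succ n ih =>
    rw [Finset.prod_range_succ]
    exact (hindep.indepFun_prod_range_succ hmeas n).integrable_mul ih (hint n)

theorem submartingale_prod_range (hmeas : ∀ k, Measurable (f k)) (hindep : iIndepFun f P)
    (hint : ∀ k, Integrable (f k) P) (hnonneg : ∀ k ω, 0 ≤ f k ω)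
    (hmean : ∀ k, 1 ≤ ∫ ω, f k ω ∂P) :
    Submartingale (fun n => ∏ k ∈ Finset.range (n + 1), f k)
      (Filtration.natural f fun k => (hmeas k).stronglyMeasurable) P := by
  set 𝒢 := Filtration.natural f fun k => (hmeas k).stronglyMeasurable
  have hadapted : StronglyAdapted 𝒢 fun n => ∏ k ∈ Finset.range (n + 1), f k := fun n =>
    Finset.stronglyMeasurable_prod _ fun k hk =>
      ((Filtration.stronglyAdapted_natural fun k => (hmeas k).stronglyMeasurable) k).mono
        (𝒢.mono (Finset.mem_range_succ_iff.1 hk))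
  refine submartingale_nat hadapted
    (fun n => integrable_prod_range hmeas hindep hint (n + 1)) fun n => ?_
  have hpull := condExp_mul_of_stronglyMeasurable_left (hadapted n)
    (Finset.prod_range_succ f (n + 1) ▸ integrable_prod_range hmeas hindep hint (n + 2))
    (hint (n + 1))
  have hcond := hindep.condExp_natural_ae_eq_of_lt (fun k => (hmeas k).stronglyMeasurable)
    n.lt_succ_self
  rw [Finset.prod_range_succ f (n + 1)]
  filter_upwards [hpull, hcond] with ω hω hω'
  rw [hω, Pi.mul_apply, hω', Finset.prod_apply]
  exact le_mul_of_one_le_right (Finset.prod_nonneg fun k _ => hnonneg k ω) (hmean (n + 1))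

end MaximalInequality

section SubGaussian

variable {Ω : Type*} [MeasurableSpace Ω] {P : Measure Ω} [IsProbabilityMeasure P] {ξ : ℕ → Ω → ℝ}
  {c : ℝ≥0}

theorem one_le_integral_exp_mul {η : Ω → ℝ} (hη : HasSubgaussianMGF η c P)
    (hmean : ∫ ω, η ω ∂P = 0) (t : ℝ) : 1 ≤ ∫ ω, Real.exp (t * η ω) ∂P := by
  have hlin : Integrable (fun ω => t * η ω) P := hη.integrable.const_mul t
  calc (1 : ℝ) = ∫ ω, (t * η ω + 1) ∂P := by
        rw [integral_add hlin (integrable_const 1), integral_const_mul, hmean]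
        simp
    _ ≤ ∫ ω, Real.exp (t * η ω) ∂P :=
        integral_mono (hlin.add (integrable_const 1)) (hη.integrable_exp_mul t)
          fun ω => Real.add_one_le_exp _

theorem measure_exists_le_exp_mul_sum_le (hmeas : ∀ k, Measurable (ξ k)) (hindep : iIndepFun ξ P)
    (hsub : ∀ k, HasSubgaussianMGF (ξ k) c P) (hmean : ∀ k, ∫ ω, ξ k ω ∂P = 0) (t : ℝ)
    {r : ℝ≥0} (hr : 0 < r) (n : ℕ) :
    P {ω | ∃ m ≤ n, (r : ℝ) ≤ Real.exp (t * ∑ k ∈ Finset.range (m + 1), ξ k ω)} ≤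
      ENNReal.ofReal (Real.exp ((n + 1 : ℕ) * c * t ^ 2 / 2) / r) := by
  have hexp : Measurable fun x : ℝ => Real.exp (t * x) := by fun_prop
  have hprod : ∀ m ω, (∏ k ∈ Finset.range m, fun ω => Real.exp (t * ξ k ω)) ω =
      Real.exp (t * ∑ k ∈ Finset.range m, ξ k ω) := fun m ω => by
    rw [Finset.prod_apply, ← Real.exp_sum, Finset.mul_sum]
  have hmax := measure_exists_le_le_of_submartingale (submartingale_prod_range
    (fun k => hexp.comp (hmeas k)) (hindep.comp _ fun _ => hexp)
    (fun k => (hsub k).integrable_exp_mul t) (fun k ω => (Real.exp_pos _).le)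
    fun k => one_le_integral_exp_mul (hsub k) (hmean k) t)
    (fun m ω => (Real.exp_pos _).le.trans_eq (hprod (m + 1) ω).symm) hr n
  simp only [Function.comp_def, hprod] at hmax
  refine hmax.trans (ENNReal.ofReal_le_ofReal (div_le_div_of_nonneg_right ?_ r.coe_nonneg))
  simpa [mgf] using (HasSubgaussianMGF.sum_of_iIndepFun hindep (s := Finset.range (n + 1))
    fun k _ => hsub k).mgf_le t

theorem measure_dyadic_block_le (hmeas : ∀ k, Measurable (ξ k)) (hindep : iIndepFun ξ P)
    (hsub : ∀ k, HasSubgaussianMGF (ξ k) c P) (hmean : ∀ k, ∫ ω, ξ k ω ∂P = 0) (j : ℕ) :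
    P {ω | ∃ m ≤ 2 ^ (j + 1) - 1, ((j : ℝ) + 1) ^ 2 ≤
      Real.exp ((√(2 ^ j))⁻¹ * ∑ k ∈ Finset.range (m + 1), ξ k ω)} ≤
        ENNReal.ofReal (Real.exp c / ((j : ℝ) + 1) ^ 2) := by
  have hexponent : ((2 ^ (j + 1) : ℕ) : ℝ) * c * ((√(2 ^ j))⁻¹) ^ 2 / 2 = c := by
    rw [inv_pow, Real.sq_sqrt (by positivity)]
    push_cast
    field_simp
    ring
  have h := measure_exists_le_exp_mul_sum_le hmeas hindep hsub hmean (√(2 ^ j))⁻¹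
    (r := ((j : ℝ≥0) + 1) ^ 2) (by positivity) (2 ^ (j + 1) - 1)
  rw [Nat.sub_add_cancel Nat.one_le_two_pow, hexponent] at h
  exact_mod_cast h

theorem tendsto_natLog_two_atTop : Tendsto (Nat.log 2) atTop atTop :=
  tendsto_atTop_atTop.2 fun b => ⟨2 ^ b, fun _ hN => Nat.le_log_of_pow_le one_lt_two hN⟩

theorem ae_eventually_sum_lt (hmeas : ∀ k, Measurable (ξ k)) (hindep : iIndepFun ξ P)
    (hsub : ∀ k, HasSubgaussianMGF (ξ k) c P) (hmean : ∀ k, ∫ ω, ξ k ω ∂P = 0) :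
    ∀ᵐ ω ∂P, ∀ᶠ N : ℕ in atTop,
      ∑ k ∈ Finset.range N, ξ k ω < 2 * Real.log (Nat.log 2 N + 1) * √N := by
  have hsummable : Summable fun j : ℕ => Real.exp c / ((j : ℝ) + 1) ^ 2 := by
    have h := (summable_nat_add_iff 1).2 (Real.summable_nat_pow_inv.2 one_lt_two)
    simpa [div_eq_mul_inv] using h.mul_left (Real.exp c)
  have hBC := ae_eventually_notMem (ne_top_of_le_ne_top hsummable.tsum_ofReal_ne_top
    (ENNReal.tsum_le_tsum (measure_dyadic_block_le hmeas hindep hsub hmean)))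
  filter_upwards [hBC] with ω hω
  filter_upwards [tendsto_natLog_two_atTop.eventually hω, eventually_gt_atTop 0]
    with N hN hpos
  have hlow : 2 ^ Nat.log 2 N ≤ N := Nat.pow_log_le_self 2 hpos.ne'
  have hhigh : N < 2 ^ (Nat.log 2 N + 1) := Nat.lt_pow_succ_log_self one_lt_two N
  generalize Nat.log 2 N = j at hN hlow hhigh ⊢
  have hlt := not_le.1 fun h => hN ⟨N - 1, Nat.sub_le_sub_right hhigh.le 1, h⟩
  rw [Nat.sub_add_cancel hpos, ← Real.lt_log_iff_exp_lt (by positivity), Real.log_pow,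
    inv_mul_lt_iff₀ (by positivity), mul_comm] at hlt
  refine hlt.trans_le (mul_le_mul_of_nonneg_left (Real.sqrt_le_sqrt (by exact_mod_cast hlow)) ?_)
  have := Real.log_natCast_nonneg (j + 1)
  push_cast at this
  positivity

theorem isLittleO_sq_mul_log_log :
    (fun N : ℕ => (2 * Real.log (Nat.log 2 N + 1) * √N) ^ 2) =o[atTop]
      fun N : ℕ => N * Real.log N := by
  have hlog₂ : (fun N : ℕ => (Nat.log 2 N : ℝ)) =O[atTop] fun N : ℕ => Real.log N :=
    .of_bound (Real.log 2)⁻¹ <| .of_forall fun N => by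
      rw [Real.norm_natCast, Real.norm_of_nonneg (Real.log_natCast_nonneg N), inv_mul_eq_div]
      exact Real.natLog_le_logb N 2
  have hone : (fun _ => (1 : ℝ)) =o[atTop] fun N : ℕ => Real.log N :=
    Real.isLittleO_const_log_atTop.comp_tendsto tendsto_natCast_atTop_atTop
  have hloglog := ((Real.isLittleO_pow_log_id_atTop (n := 2)).comp_tendsto
    (tendsto_atTop_add_const_right _ 1 (tendsto_natCast_atTop_atTop.comp
      tendsto_natLog_two_atTop))).trans_isBigO (hlog₂.add hone.isBigO)
  refine ((isBigO_refl (fun N : ℕ => (N : ℝ)) atTop).mul_isLittleO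
    (hloglog.const_mul_left 4)).congr_left fun N => ?_
  rw [mul_pow, Real.sq_sqrt N.cast_nonneg]
  simp only [Function.comp_apply]
  ring

/- A weak form of the law of the iterated logarithm: any bound `o(√(N log N))` is enough below. -/
theorem ae_isLittleO_sq_sum (hmeas : ∀ k, Measurable (ξ k)) (hindep : iIndepFun ξ P)
    (hsub : ∀ k, HasSubgaussianMGF (ξ k) c P) (hmean : ∀ k, ∫ ω, ξ k ω ∂P = 0) :
    ∀ᵐ ω ∂P, (fun N : ℕ => (∑ k ∈ Finset.range N, ξ k ω) ^ 2) =o[atTop]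
      fun N : ℕ => N * Real.log N := by
  filter_upwards [ae_eventually_sum_lt hmeas hindep hsub hmean,
    ae_eventually_sum_lt (fun k => (hmeas k).neg)
      (hindep.comp (fun _ x => -x) fun _ => measurable_neg) (fun k => (hsub k).neg)
      (fun k => by simp [integral_neg, hmean])] with ω hupper hlower
  refine (IsBigO.of_norm_eventuallyLE ?_).trans_isLittleO isLittleO_sq_mul_log_log
  filter_upwards [hupper, hlower] with N hN hN'
  simp only [Pi.neg_apply, Finset.sum_neg_distrib] at hN'
  rw [Real.norm_of_nonneg (sq_nonneg _)]
  exact sq_le_sq' (by linarith) hN.le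

end SubGaussian

section Counting

variable {C D : Type*} [DecidableEq C] [DecidableEq D]

/-- The number of indices `k < n` at which the value `z` occurs in the sequence `w`. -/
def occCount (w : ℕ → C) (n : ℕ) (z : C) : ℕ :=
  Nat.count (fun k => w k = z) n

/-- The number of indices `k < n` at which the value `z` occurs in the sequence `w` and is observed,
that is, `o k` is true. -/
def obsCount (o : ℕ → Bool) (w : ℕ → C) (n : ℕ) (z : C) : ℕ :=
  Nat.count (fun k => o k ∧ w k = z) n

theorem sum_occCount [Fintype C] (w : ℕ → C) (n : ℕ) : ∑ z, occCount w n z = n := by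
  induction n with
  | zero => simp [occCount]
  | succ n ih => simpa [occCount, Nat.count_succ, Finset.sum_add_distrib] using ih

theorem natCast_occCount_eq_sum_indicator (w : ℕ → C) (n : ℕ) (z : C) :
    (occCount w n z : ℝ) = ∑ k ∈ Finset.range n, Set.indicator {z} 1 (w k) := by
  simp [occCount, Nat.count_eq_card_filter_range, Set.indicator_apply]

theorem marginal_obsCount [Fintype C] (φ : C → D) (o : ℕ → Bool) (w : ℕ → C) (n : ℕ) :
    marginal φ (obsCount o w n) = obsCount o (φ ∘ w) n := by
  funext x
  simp only [marginal, obsCount, Nat.count_eq_card_filter_range, Function.comp_apply]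
  rw [Finset.card_eq_sum_card_fiberwise (f := w) (t := {z | φ z = x}) fun k hk => by simp_all]
  refine Finset.sum_congr rfl fun z hz => congrArg Finset.card ?_
  ext k
  simp only [Finset.mem_filter, Finset.mem_univ, true_and] at hz ⊢
  grind

theorem obsCount_eq_occCount_nth (o : ℕ → Bool) (w : ℕ → C) (n : ℕ) :
    obsCount o w n =
      occCount (fun m => w (Nat.nth (fun k => o k) m)) (Nat.count (fun k => o k) n) := by
  funext z
  rw [obsCount, occCount]
  induction n with
  | zero => simp
  | succ n ih =>
    by_cases hn : o n <;> simp [Nat.count_succ, ih, hn, Nat.nth_count (p := fun k => o k)]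

theorem infinite_setOf_of_tendsto_count {s : ℕ → Prop} [DecidablePred s]
    (h : Tendsto (Nat.count s) atTop atTop) : {k | s k}.Infinite := fun hfin => by
  obtain ⟨n, hn⟩ := (h.eventually_gt_atTop hfin.toFinset.card).exists
  exact hn.not_ge (Nat.count_le_card hfin n)

end Counting

section IndependentSamples

variable {Ω : Type*} [MeasurableSpace Ω] {P : Measure Ω} [IsProbabilityMeasure P]

theorem ae_isLittleO_sq_sum_sub {ζ : ℕ → Ω → ℝ} {u v m : ℝ} (hmeas : ∀ k, Measurable (ζ k))
    (hindep : iIndepFun ζ P) (hmem : ∀ k ω, ζ k ω ∈ Set.Icc u v) (hmean : ∀ k, ∫ ω, ζ k ω ∂P = m) :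
    ∀ᵐ ω ∂P, (fun N : ℕ => (∑ k ∈ Finset.range N, ζ k ω - N * m) ^ 2) =o[atTop]
      fun N : ℕ => N * Real.log N := by
  have hsub : ∀ k, HasSubgaussianMGF (fun ω => ζ k ω - m) ((‖v - u‖₊ / 2) ^ 2) P := fun k =>
    hmean k ▸ hasSubgaussianMGF_of_mem_Icc (hmeas k).aemeasurable (ae_of_all _ (hmem k))
  have hcentred : ∀ k, ∫ ω, (ζ k ω - m) ∂P = 0 := fun k => by
    rw [integral_sub (.of_mem_Icc u v (hmeas k).aemeasurable (ae_of_all _ (hmem k)))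
      (integrable_const m), hmean]
    simp
  simpa using ae_isLittleO_sq_sum (fun k => (hmeas k).sub_const m)
    (hindep.comp (fun _ x => x - m) fun _ => by fun_prop) hsub hcentred

variable {C : Type*} [Fintype C] [DecidableEq C] [MeasurableSpace C] [MeasurableSingletonClass C]
  {Z : ℕ → Ω → C} {p : C → ℝ}

theorem ae_isTypicalCounts (hmeas : ∀ k, Measurable (Z k)) (hindep : iIndepFun Z P)
    (hp : ∀ k z, P.real {ω | Z k ω = z} = p z) :
    ∀ᵐ ω ∂P, IsTypicalCounts p (occCount fun k => Z k ω) := by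
  have hnull : ∀ᵐ ω ∂P, ∀ z, p z = 0 → ∀ k, Z k ω ≠ z := by
    refine ae_all_iff.2 fun z => ae_all_iff.2 fun hz => ae_all_iff.2 fun k => ?_
    have := hp k z
    rw [hz, measureReal_eq_zero_iff] at this
    simpa [ae_iff] using this
  have hind : ∀ z, Measurable (Set.indicator {z} 1 : C → ℝ) := fun z => measurable_of_finite _
  have hdev := ae_all_iff.2 fun z => ae_isLittleO_sq_sum_sub (u := 0) (v := 1) (m := p z)
    (fun k => (hind z).comp (hmeas k)) (hindep.comp _ fun _ => hind z)
    (fun k ω => ⟨Set.indicator_nonneg (by simp) _, Set.indicator_le_self' (by simp) _⟩)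
    fun k => ((integral_indicator_one (hmeas k (measurableSet_singleton z))).trans (hp k z))
  filter_upwards [hnull, hdev] with ω hnull hdev
  refine ⟨sum_occCount _, fun z hz N => ?_, fun z => ?_⟩
  · simp [occCount, Nat.count_eq_card_filter_range, hnull z hz]
  · simpa only [natCast_occCount_eq_sum_indicator, Function.comp_apply] using hdev z

end IndependentSamples

section MutualInfo

variable {Ω A B : Type*} [MeasurableSpace Ω] {P : Measure Ω}

theorem marginal_measureReal {C : Type*} [Fintype C] [MeasurableSpace C]
    [MeasurableSingletonClass C] [DecidableEq A] [IsFiniteMeasure P] {W : Ω → C}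
    (hW : Measurable W) (φ : C → A) :
    marginal φ (fun z => P.real {ω | W ω = z}) = fun x => P.real {ω | φ (W ω) = x} := by
  funext x
  refine (sum_measureReal_preimage_singleton _ fun z _ => hW (measurableSet_singleton z)).trans ?_
  congr 1
  ext ω
  simp

theorem measureReal_mem_stdSimplex {C : Type*} [Fintype C] [MeasurableSpace C]
    [MeasurableSingletonClass C] [IsProbabilityMeasure P] {W : Ω → C} (hW : Measurable W) :
    (fun z => P.real {ω | W ω = z}) ∈ stdSimplex ℝ C :=
  ⟨fun _ => measureReal_nonneg, (sum_measureReal_preimage_singleton Finset.univ fun z _ =>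
    hW (measurableSet_singleton z)).trans (by simp)⟩

theorem mutualInfo_fst_snd_eq_massMutualInfo [IsProbabilityMeasure P] [Fintype A] [Fintype B]
    [DecidableEq A] [DecidableEq B] [MeasurableSpace A] [MeasurableSpace B]
    [MeasurableSingletonClass A] [MeasurableSingletonClass B] {W : Ω → A × B} (hW : Measurable W) :
    mutualInfo P (fun ω => (W ω).1) (fun ω => (W ω).2) =
      massMutualInfo fun z => P.real {ω | W ω = z} := by
  rw [massMutualInfo_eq_relEntropy (measureReal_mem_stdSimplex hW), marginal_measureReal hW,
    marginal_measureReal hW, mutualInfo, relEntropy, Fintype.sum_prod_type]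
  simp only [Prod.ext_iff]

end MutualInfo

section RandomPattern

variable {Ω : Type*} [MeasurableSpace Ω] {P : Measure Ω} [IsProbabilityMeasure P]

theorem ae_of_indepFun {E F : Type*} [MeasurableSpace E] [MeasurableSpace F] {S : Ω → E} {T : Ω → F}
    (hS : Measurable S) (hT : Measurable T) (hST : IndepFun S T P) {G : E → F → Prop}
    (hG : MeasurableSet {q : E × F | G q.1 q.2}) (h : ∀ s, ∀ᵐ ω ∂P, G s (T ω)) :
    ∀ᵐ ω ∂P, G (S ω) (T ω) := by
  have hlaw := (indepFun_iff_map_prod_eq_prod_map_map hS.aemeasurable hT.aemeasurable).1 hST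
  have := Measure.isProbabilityMeasure_map (μ := P) hT.aemeasurable
  have := Measure.isProbabilityMeasure_map (μ := P) hS.aemeasurable
  rw [← ae_map_iff (p := fun q : E × F => G q.1 q.2) (hS.prodMk hT).aemeasurable hG, hlaw,
    Measure.ae_prod_iff_ae_ae hG]
  exact ae_of_all _ fun s => (ae_map_iff hT.aemeasurable (measurable_prodMk_left hG)).2 (h s)

theorem measurable_natCount {E : Type*} [MeasurableSpace E] {s : ℕ → E → Prop}
    [∀ k q, Decidable (s k q)] (hs : ∀ k, MeasurableSet {q | s k q}) (n : ℕ) :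
    Measurable fun q => Nat.count (fun k => s k q) n := by
  induction n with
  | zero => simp
  | succ n ih =>
    simp only [Nat.count_succ]
    exact ih.add (Measurable.ite (hs n) measurable_const measurable_const)

section Measurability

variable {C : Type*} [MeasurableSpace C]

theorem measurableSet_observed (k : ℕ) :
    MeasurableSet {q : (ℕ → Bool) × (ℕ → C) | q.1 k = true} :=
  (by fun_prop : Measurable fun q : (ℕ → Bool) × (ℕ → C) => q.1 k) (measurableSet_singleton true)

variable [DecidableEq C] [MeasurableSingletonClass C]

theorem measurable_obsCount (n : ℕ) :
    Measurable fun q : (ℕ → Bool) × (ℕ → C) => obsCount q.1 q.2 n := by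
  refine measurable_pi_lambda _ fun z =>
    measurable_natCount (s := fun k (q : (ℕ → Bool) × (ℕ → C)) => q.1 k ∧ q.2 k = z) (fun k => ?_) n
  have hvalue : Measurable fun q : (ℕ → Bool) × (ℕ → C) => q.2 k := by fun_prop
  exact (measurableSet_observed k).inter (hvalue (measurableSet_singleton z))

theorem measurableSet_tendsto_count_imp_eventually_obsCount_mem [Finite C] (T : Set (C → ℕ)) :
    MeasurableSet {q : (ℕ → Bool) × (ℕ → C) | Tendsto (Nat.count fun k => q.1 k) atTop atTop →
      ∀ᶠ n in atTop, obsCount q.1 q.2 n ∈ T} := by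
  refine (measurableSet_tendsto atTop (measurable_natCount measurableSet_observed)).imp ?_
  have hliminf := MeasurableSet.measurableSet_liminf fun n =>
    measurable_obsCount (C := C) n T.to_countable.measurableSet
  convert hliminf using 1
  ext q
  simp [mem_liminf_iff_eventually_mem]

end Measurability

variable {A B : Type*} [Fintype A] [Fintype B] [DecidableEq A] [DecidableEq B] [Nontrivial A]
  [Nontrivial B] [MeasurableSpace A] [MeasurableSpace B] [MeasurableSingletonClass A]
  [MeasurableSingletonClass B] {Z : ℕ → Ω → A × B} {a₁ : A → ℝ} {a₂ : B → ℝ} {b : A × B → ℝ}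

theorem ae_eventually_logRatio_obsCount_nonpos_iff (hmeas : ∀ k, Measurable (Z k))
    (hindep : iIndepFun Z P) (hident : ∀ k, IdentDistrib (Z k) (Z 0) P P)
    (ha₁ : ∀ x, 0 < a₁ x) (ha₂ : ∀ y, 0 < a₂ y) (hb : ∀ z, 0 < b z)
    (hsupp : ((∀ x, 0 < P.real {ω | (Z 0 ω).1 = x}) ∧ ∀ y, 0 < P.real {ω | (Z 0 ω).2 = y}) ∨
      (∀ x, a₁ x = 1 / 2) ∧ (∀ y, a₂ y = 1 / 2) ∧ ∀ z, b z = 1 / 2)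
    {o : ℕ → Bool} (ho : Tendsto (Nat.count fun k => o k) atTop atTop) :
    ∀ᵐ ω ∂P, ∀ᶠ n in atTop, (logRatio a₁ a₂ b (obsCount o (fun k => Z k ω) n) ≤ 0 ↔
      mutualInfo P (fun ω' => (Z 0 ω').1) (fun ω' => (Z 0 ω').2) = 0) := by
  set r := Nat.nth fun k => o k
  have htypical := ae_isTypicalCounts (fun m => hmeas (r m))
    (hindep.precomp (Nat.nth_injective (infinite_setOf_of_tendsto_count ho)))
    (p := fun z => P.real {ω | Z 0 ω = z}) fun m z =>
      congrArg ENNReal.toReal ((hident (r m)).measure_mem_eq (measurableSet_singleton z))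
  simp only [mutualInfo_fst_snd_eq_massMutualInfo (hmeas 0), obsCount_eq_occCount_nth]
  filter_upwards [htypical] with ω hω
  refine ho.eventually (hω.eventually_logRatio_nonpos_iff ha₁ ha₂ hb ?_)
  simpa only [marginal_measureReal (hmeas 0)] using hsupp

theorem ae_tendsto_count_imp_eventually_logRatio_nonpos_iff (hmeas : ∀ k, Measurable (Z k))
    (hindep : iIndepFun Z P) (hident : ∀ k, IdentDistrib (Z k) (Z 0) P P)
    {O : ℕ → Ω → Bool} (hO : ∀ k, Measurable (O k))
    (hOZ : IndepFun (fun ω k => O k ω) (fun ω k => Z k ω) P)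
    (ha₁ : ∀ x, 0 < a₁ x) (ha₂ : ∀ y, 0 < a₂ y) (hb : ∀ z, 0 < b z)
    (hsupp : ((∀ x, 0 < P.real {ω | (Z 0 ω).1 = x}) ∧ ∀ y, 0 < P.real {ω | (Z 0 ω).2 = y}) ∨
      (∀ x, a₁ x = 1 / 2) ∧ (∀ y, a₂ y = 1 / 2) ∧ ∀ z, b z = 1 / 2) :
    ∀ᵐ ω ∂P, Tendsto (Nat.count fun k => O k ω) atTop atTop → ∀ᶠ n in atTop,
      (logRatio a₁ a₂ b (obsCount (fun k => O k ω) (fun k => Z k ω) n) ≤ 0 ↔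
        mutualInfo P (fun ω' => (Z 0 ω').1) (fun ω' => (Z 0 ω').2) = 0) := by
  have hG := measurableSet_tendsto_count_imp_eventually_obsCount_mem {c | logRatio a₁ a₂ b c ≤ 0 ↔
    mutualInfo P (fun ω' => (Z 0 ω').1) (fun ω' => (Z 0 ω').2) = 0}
  refine ae_of_indepFun (G := fun o w => Tendsto (Nat.count fun k => o k) atTop atTop →
    ∀ᶠ n in atTop, (logRatio a₁ a₂ b (obsCount o w n) ≤ 0 ↔ _)) (measurable_pi_lambda _ hO)
    (measurable_pi_lambda _ hmeas) hOZ hG fun o => ?_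
  by_cases ho : Tendsto (Nat.count fun k => o k) atTop atTop
  · filter_upwards [ae_eventually_logRatio_obsCount_nonpos_iff hmeas hindep hident ha₁ ha₂ hb hsupp
      ho] with ω hω _ using hω
  · exact ae_of_all _ fun ω h => absurd h ho

end RandomPattern

section Frame

variable {p : ℕ} {α : Fin p → ℕ}

section Sign

variable {a : (i : Fin p) → Fin (α i) → ℝ} {b : (i j : Fin p) → Fin (α i) × Fin (α j) → ℝ}
  {d : Frame α} {n : ℕ} {i j : Fin p}

theorem estJ_nonpos_iff (hn : 0 < n) : estJ a b d n i j ≤ 0 ↔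
    Real.log (qJoint b d n i j / (qMarg a d n i j * qMarg a d n j i)) ≤ 0 := by
  rw [estJ, one_div, inv_mul_le_iff₀ (Nat.cast_pos.2 hn), mul_zero]

theorem estK_nonpos_iff (hobs : 0 < numObs d n i j) : estK a b d n i j ≤ 0 ↔
    Real.log (qJoint b d n i j / (qMarg a d n i j * qMarg a d n j i)) ≤ 0 := by
  rw [estK, one_div, inv_mul_le_iff₀ (Nat.cast_pos.2 hobs), mul_zero]

end Sign

variable (x : ℕ → (i : Fin p) → Fin (α i)) (y : ℕ → Fin p → Bool) (n : ℕ)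
  (i j : Fin p)

theorem numObs_mask : numObs (mask x y) n i j = Nat.count (fun k => y k i && y k j) n := by
  simp [numObs, rows, mask, Nat.count_eq_card_filter_range]

theorem pairCount_mask : pairCount (mask x y) (rows (mask x y) n i j) i j =
    obsCount (fun k => y k i && y k j) (fun k => (x k i, x k j)) n := by
  funext z
  rw [pairCount, rows, Finset.filter_filter, obsCount, Nat.count_eq_card_filter_range]
  congr 1
  ext k
  grind [mask]

theorem count_mask_left : count (mask x y) (rows (mask x y) n i j) i =
    obsCount (fun k => y k i && y k j) (fun k => x k i) n := by
  funext u
  rw [count, rows, Finset.filter_filter, obsCount, Nat.count_eq_card_filter_range]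
  congr 1
  ext k
  grind [mask]

theorem log_qJoint_div_qMarg_mask (a : (i : Fin p) → Fin (α i) → ℝ)
    (b : (i j : Fin p) → Fin (α i) × Fin (α j) → ℝ) :
    Real.log (qJoint b (mask x y) n i j / (qMarg a (mask x y) n i j * qMarg a (mask x y) n j i)) =
      logRatio (a i) (a j) (b i j)
        (obsCount (fun k => y k i && y k j) (fun k => (x k i, x k j)) n) := by
  rw [qJoint, qMarg, qMarg, pairCount_mask, count_mask_left, count_mask_left, logRatio,
    marginal_obsCount, marginal_obsCount]
  simp only [Function.comp_def, Bool.and_comm]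

end Frame

end IncompleteData

open IncompleteData in
theorem proposition4_general {Ω : Type*} [MeasurableSpace Ω] (P : Measure Ω)
    [IsProbabilityMeasure P] {p : ℕ} (α : Fin p → ℕ) {i j : Fin p} (hi : 2 ≤ α i) (hj : 2 ≤ α j)
    (X : ℕ → Ω → (i : Fin p) → Fin (α i)) (hXmeas : ∀ k, Measurable (X k)) (hXindep : iIndepFun X P)
    (hXident : ∀ k, IdentDistrib (X k) (X 0) P P)
    (Y : ℕ → Ω → Fin p → Bool) (hYmeas : ∀ k, Measurable (Y k))
    (hXY : IndepFun (fun ω k => X k ω) (fun ω k => Y k ω) P)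
    (a : (i : Fin p) → Fin (α i) → ℝ) (hai : ∀ x, 0 < a i x) (haj : ∀ x, 0 < a j x)
    (b : (i j : Fin p) → Fin (α i) × Fin (α j) → ℝ) (hb : ∀ z, 0 < b i j z)
    (hsupp : ((∀ x, 0 < P.real {ω | X 0 ω i = x}) ∧ ∀ x, 0 < P.real {ω | X 0 ω j = x}) ∨
      (∀ x, a i x = 1 / 2) ∧ (∀ x, a j x = 1 / 2) ∧ ∀ z, b i j z = 1 / 2) :
    ∀ᵐ ω ∂P, Tendsto (fun n => numObs
        (mask (fun k => X k ω) (fun k => Y k ω)) n i j) atTop atTop →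
      ∀ᶠ n in atTop,
        (estJ a b (mask (fun k => X k ω) (fun k => Y k ω)) n i j ≤ 0 ↔
          mutualInfo P (fun ω' => X 0 ω' i) (fun ω' => X 0 ω' j) = 0) ∧
        (mutualInfo P (fun ω' => X 0 ω' i) (fun ω' => X 0 ω' j) = 0 ↔
          estK a b (mask (fun k => X k ω) (fun k => Y k ω)) n i j ≤ 0) := by
  have : Nontrivial (Fin (α i)) := Fin.nontrivial_iff_two_le.2 hi
  have : Nontrivial (Fin (α j)) := Fin.nontrivial_iff_two_le.2 hj
  have hpair : Measurable fun x : (i : Fin p) → Fin (α i) => (x i, x j) := by fun_prop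
  have hobserved : Measurable fun y : Fin p → Bool => y i && y j := measurable_of_finite _
  filter_upwards [ae_tendsto_count_imp_eventually_logRatio_nonpos_iff
    (fun k => hpair.comp (hXmeas k)) (hXindep.comp _ fun _ => hpair)
    (fun k => (hXident k).comp hpair) (fun k => hobserved.comp (hYmeas k))
    (hXY.symm.comp (φ := fun y k => y k i && y k j) (ψ := fun x k => (x k i, x k j))
      (by fun_prop) (by fun_prop)) hai haj hb hsupp] with ω hω htendsto
  have hcount : Tendsto (Nat.count fun k => Y k ω i && Y k ω j) atTop atTop := by
    simpa only [numObs_mask] using htendsto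
  filter_upwards [hω hcount, eventually_gt_atTop 0, htendsto.eventually_gt_atTop 0]
    with n hn hpos hobs
  rw [estJ_nonpos_iff hpos, estK_nonpos_iff hobs, log_qJoint_div_qMarg_mask]
  exact ⟨hn, hn.symm⟩

theorem proposition4 {Ω : Type*} [MeasurableSpace Ω] (P : Measure Ω) [IsProbabilityMeasure P]
    {p : ℕ} (α : Fin p → ℕ) (hα : ∀ i, 2 ≤ α i)
    -- the complete samples, independent and identically distributed
    (X : ℕ → Ω → (i : Fin p) → Fin (α i))
    (hXmeas : ∀ k, Measurable (X k))
    (hXindep : iIndepFun X P)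
    (hXident : ∀ k, IdentDistrib (X k) (X 0) P P)
    -- `Y k ω i` tells whether the value `X k ω i` is observed; the pattern of missing
    -- values is an arbitrary process that is independent of the samples
    (Y : ℕ → Ω → Fin p → Bool)
    (hYmeas : ∀ k, Measurable (Y k))
    (hXY : IndepFun (fun ω k => X k ω) (fun ω k => Y k ω) P)
    -- positive parameters of the Bayes measures
    (a : (i : Fin p) → Fin (α i) → ℝ) (ha : ∀ i x, 0 < a i x)
    (b : (i j : Fin p) → Fin (α i) × Fin (α j) → ℝ) (hb : ∀ i j, i ≠ j → ∀ z, 0 < b i j z)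
    -- every value is really taken; this is not needed when all the parameters are `1 / 2`
    (hsupp : (∀ i x, 0 < P.real {ω | X 0 ω i = x}) ∨
      ((∀ i x, a i x = 1 / 2) ∧ ∀ i j, i ≠ j → ∀ z, b i j z = 1 / 2))
    (hobs : ∀ i j, i ≠ j → ∀ᵐ ω ∂P,
      Tendsto (fun n => IncompleteData.numObs
        (IncompleteData.mask (fun k => X k ω) (fun k => Y k ω)) n i j) atTop atTop) :
    ∀ᵐ ω ∂P, ∀ᶠ n in atTop, ∀ i j, i ≠ j →
      (IncompleteData.estJ a b (IncompleteData.mask (fun k => X k ω) (fun k => Y k ω)) n i j ≤ 0 ↔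
        IncompleteData.mutualInfo P (fun ω' => X 0 ω' i) (fun ω' => X 0 ω' j) = 0) ∧
      (IncompleteData.mutualInfo P (fun ω' => X 0 ω' i) (fun ω' => X 0 ω' j) = 0 ↔
        IncompleteData.estK a b (IncompleteData.mask (fun k => X k ω) (fun k => Y k ω)) n i j ≤ 0) := by
  simp only [eventually_all]
  intro i j hij
  filter_upwards [proposition4_general P α (hα i) (hα j) X hXmeas hXindep hXident Y hYmeas hXY a
    (ha i) (ha j) b (hb i j hij) (hsupp.imp (fun h => ⟨h i, h j⟩) fun h =>
      ⟨h.1 i, h.1 j, h.2 i j hij⟩), hobs i j hij] with ω hω htendsto using hω htendsto
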